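/- Let $\mathcal P$ be a classical polar space of rank $n$ over a finite field $F$, that is, the geometry of the totally singular (respectively totally isotropic) subspaces of a finite-dimensional $F$-vector space $V$ carrying a nondegenerate quadratic form (respectively a nondegenerate alternating or Hermitian form, the latter with respect to a field automorphism of order two); the rank $n$ is the largest dimension of such a subspace. Suppose that $n$ is even. Let $\mathcal D$ be a set of $n$-dimensional subspaces of $\mathcal P$ that is an $n$-dimensional dual arc: any two distinct members meet in exactly a one-dimensional space and no three distinct members meet nontrivially. More generally, let $\mathcal D$ be a constant-distance code of $n$-dimensional subspaces of $\mathcal P$ with any two distinct members $S,T$ at subspace distance $\dim(S+T)-\dim(S\cap T)=2(n-1)$ (no condition on triples). If $|F|=Q$ and $\mathcal P$ has parameters $(Q,Q^e)$, meaning that every $(n-1)$-dimensional subspace of $\mathcal P$ is contained in precisely $Q^e+1$ of its $n$-dimensional subspaces, then $$|\mathcal D|\le Q^{(n-1)e}+1 .$$ Concretely, $|\mathcal D|$ is at most: - $2$ if $\mathcal P=Q^+(2n-1,q)$ (quadratic form on $V(2n,q)$); - $q^{n-1}+1$ if $\mathcal P=Q(2n,q)$ (quadratic form on $V(2n+1,q)$),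 $\mathcal P=W(2n-1,q)$ (alternating form on $V(2n,q)$), or $\mathcal P=H(2n-1,q^2)$ (Hermitian form on $V(2n,q^2)$); - $q^{2n-2}+1$ if $\mathcal P=Q^-(2n+1,q)$ (quadratic form on $V(2n+2,q)$); - $q^{3(n-1)}+1$ if $\mathcal P=H(2n,q^2)$ (Hermitian form on $V(2n+1,q^2)$). Here $V(N,r)$ denotes an $N$-dimensional vector space over the field with $r$ elements, and $\mathcal P$ has rank $n$ in each case. -/

import Mathlib

open Module

/-- A classical polar space on the vector space `V` over `K`, given by the form that defines it:
a nondegenerate quadratic form, a nondegenerate alternating bilinear form, or a nondegenerate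
Hermitian form with respect to a field automorphism `σ` of order two. -/
inductive ClassicalPolarSpace (K V : Type*) [Field K] [AddCommGroup V] [Module K V] where
  | quadratic (Q : QuadraticForm K V) (nondegenerate : Q.Nondegenerate)
  | symplectic (B : V →ₗ[K] V →ₗ[K] K) (alternating : B.IsAlt) (nondegenerate : B.Nondegenerate)
  | hermitian (σ : K →+* K) (involutive : ∀ a, σ (σ a) = a) (nontrivial : σ ≠ RingHom.id K)
      (B : V →ₛₗ[σ] V →ₗ[K] K) (hermitian : ∀ x y, σ (B x y) = B y x)
      (nondegenerate : B.Nondegenerate)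

namespace ClassicalPolarSpace

variable {K V : Type*} [Field K] [AddCommGroup V] [Module K V]

/-- `S` is a subspace of the polar space: totally singular for a quadratic form, totally isotropic
for a symplectic or Hermitian form. -/
def IsTotallyIsotropic : ClassicalPolarSpace K V → Submodule K V → Prop
  | quadratic Q _, S => ∀ x ∈ S, Q x = 0
  | symplectic B _ _, S => ∀ x ∈ S, ∀ y ∈ S, B x y = 0
  | hermitian _ _ _ B _ _, S => ∀ x ∈ S, ∀ y ∈ S, B x y = 0

/-- The rank of the polar space is `n`: the largest dimension of one of its subspaces. -/
def HasRank (P : ClassicalPolarSpace K V) (n : ℕ) : Prop :=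
  IsGreatest {d : ℕ | ∃ S : Submodule K V, P.IsTotallyIsotropic S ∧ finrank K S = d} n

/-- `S` is an `n`-space of the polar space. -/
def IsSpace (P : ClassicalPolarSpace K V) (n : ℕ) (S : Submodule K V) : Prop :=
  P.IsTotallyIsotropic S ∧ finrank K S = n

/-- The polar space of rank `n` over the field with `q` elements has parameters `(q, q ^ e)`:
every `(n - 1)`-space lies in precisely `q ^ e + 1` of its `n`-spaces. -/
def HasParameters (P : ClassicalPolarSpace K V) (n : ℕ) (e : ℝ) : Prop :=
  ∀ W : Submodule K V, P.IsTotallyIsotropic W → finrank K W + 1 = n →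
    ({S : Submodule K V | P.IsSpace n S ∧ W ≤ S}.ncard : ℝ) = (Nat.card K : ℝ) ^ e + 1

/-- The polar space is defined by a quadratic form. -/
def IsOrthogonal : ClassicalPolarSpace K V → Prop
  | quadratic _ _ => True
  | _ => False

/-- The polar space is defined by an alternating form. -/
def IsSymplectic : ClassicalPolarSpace K V → Prop
  | symplectic _ _ _ => True
  | _ => False

/-- The polar space is defined by a Hermitian form. -/
def IsHermitian : ClassicalPolarSpace K V → Prop
  | hermitian _ _ _ _ _ _ => True
  | _ => False

/-- The hyperbolic quadric `Q⁺(2n-1, q)`. -/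
def IsHyperbolicQuadric (P : ClassicalPolarSpace K V) (n : ℕ) : Prop :=
  P.IsOrthogonal ∧ finrank K V = 2 * n ∧ P.HasRank n

/-- The parabolic quadric `Q(2n, q)`. -/
def IsParabolicQuadric (P : ClassicalPolarSpace K V) (n : ℕ) : Prop :=
  P.IsOrthogonal ∧ finrank K V = 2 * n + 1 ∧ P.HasRank n

/-- The elliptic quadric `Q⁻(2n+1, q)`. -/
def IsEllipticQuadric (P : ClassicalPolarSpace K V) (n : ℕ) : Prop :=
  P.IsOrthogonal ∧ finrank K V = 2 * n + 2 ∧ P.HasRank n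

/-- The symplectic space `W(2n-1, q)`. -/
def IsSymplecticSpace (P : ClassicalPolarSpace K V) (n : ℕ) : Prop :=
  P.IsSymplectic ∧ finrank K V = 2 * n ∧ P.HasRank n

/-- The Hermitian variety `H(2n-1, q²)` on a space of even dimension `2n`. -/
def IsEvenHermitianVariety (P : ClassicalPolarSpace K V) (n : ℕ) : Prop :=
  P.IsHermitian ∧ finrank K V = 2 * n ∧ P.HasRank n

/-- The Hermitian variety `H(2n, q²)` on a space of odd dimension `2n + 1`. -/
def IsOddHermitianVariety (P : ClassicalPolarSpace K V) (n : ℕ) : Prop :=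
  P.IsHermitian ∧ finrank K V = 2 * n + 1 ∧ P.HasRank n

end ClassicalPolarSpace

section Arcs

variable {K V : Type*} [Field K] [AddCommGroup V] [Module K V]

/-- `D` is an `n`-dimensional dual arc: a set of `n`-dimensional subspaces, each two of which meet
in exactly a one-dimensional space, and no three of which meet nontrivially. -/
structure IsDualArc (n : ℕ) (D : Set (Submodule K V)) : Prop where
  finrank_eq : ∀ S ∈ D, finrank K S = n
  finrank_inf : ∀ S ∈ D, ∀ T ∈ D, S ≠ T → finrank K (S ⊓ T : Submodule K V) = 1
  inf_eq_bot : ∀ S ∈ D, ∀ T ∈ D, ∀ U ∈ D, S ≠ T → S ≠ U → T ≠ U → S ⊓ T ⊓ U = ⊥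

/-- The subspace distance `dim (S + T) - dim (S ∩ T)`. -/
noncomputable def subspaceDist (S T : Submodule K V) : ℕ :=
  finrank K (S ⊔ T : Submodule K V) - finrank K (S ⊓ T : Submodule K V)

/-- `D` is a constant-dimension, constant-distance subspace code: all codewords have dimension `n`
and any two distinct codewords are at subspace distance `d`. -/
structure IsConstantDistanceCode (n d : ℕ) (D : Set (Submodule K V)) : Prop where
  finrank_eq : ∀ S ∈ D, finrank K S = n
  dist_eq : ∀ S ∈ D, ∀ T ∈ D, S ≠ T → subspaceDist S T = d

end Arcs

/-!
The generators of a polar space of rank `n` are the points of a near polygon, the dual polar space.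
Its lines are the `(n - 1)`-spaces, each on `s + 1` generators, and two generators `S`, `T` are at
distance `d = n - dim (S ∩ T)`. On every line exactly one point is nearest to a given generator
(`PolarGeometry.HasRank.exists_nearest`), so, as a function of `T`, the kernel
`M S T = (-1 / s) ^ d` has sum `(-1 / s) ^ d * (1 + s * (-1 / s)) = 0` on every line.

Conversely, if `g` has sum zero on every line, then adding up the lines at distance `i` from `S`
expresses the sum of `g` over the sphere of radius `i + 1` about `S` through that over the sphere of
radius `i`, with a factor of negative sign that depends on `i` alone. Hence the sphere sums are
`(-1) ^ i * c i * g S` with constants `c i ≥ 0`, and `∑ T, M S T * g T = c * g S` with `c > 0`.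
Applied to the columns of `M` this gives `M ^ 2 = c * M`, so the symmetric kernel `M` is positive
semidefinite (`PolarGeometry.HasRank.sum_distKernel_nonneg`).

For a set of `N` generators that pairwise meet in a point, all distances are `n - 1`, which is odd
when `n` is even, so the entries of `M` on this set add up to `N * (1 - (N - 1) / s ^ (n - 1))`.
This is nonnegative, so `N ≤ s ^ (n - 1) + 1`.

It remains to determine `s` for each classical polar space. All of them are instances of
`PolarGeometry`, where for a singular vector `v` each affine line in direction `v` on which `B v` is
`1` carries the same number `τ` of singular vectors: `1` for quadratic forms, `|K|` for alternating
forms and `√|K|` for Hermitian forms. Counting singular vectors then gives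
`s = |K| ^ δ * τ` in dimension `2 * n + δ` (`PolarGeometry.HasRank.ncard_generators`).
-/

/-! ### Subspaces lying on a given subspace -/

section Subspaces

variable {K V : Type*} [Field K] [AddCommGroup V] [Module K V] [FiniteDimensional K V]

theorem Submodule.exists_le_finrank_eq (S : Submodule K V) {k : ℕ} (hk : k ≤ finrank K S) :
    ∃ U ≤ S, finrank K U = k := by
  have hli := ((finBasis K S).linearIndependent.map' S.subtype S.ker_subtype).comp _
    (Fin.castLE_injective hk)
  refine ⟨_, ?_, (finrank_span_eq_card hli).trans (Fintype.card_fin k)⟩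
  rw [Submodule.span_le]
  rintro _ ⟨i, rfl⟩
  exact (finBasis K S (Fin.castLE hk i)).2

/-- The number of hyperplanes of `K ^ (n - k)`, which is the number of `(n - 1)`-spaces between
a `k`-space and an `n`-space that contains it. -/
noncomputable def hyperplaneCount (K : Type*) [Field K] (n k : ℕ) : ℕ :=
  {X : Submodule K (Fin (n - k) → K) | finrank K X + 1 = n - k}.ncard

/-- A complement of `U` in `T` identifies the interval from `U` to `T` with the lattice of
subspaces of a space of dimension `dim T - dim U`. -/
theorem ncard_hyperplanes_containing {n : ℕ} {U T : Submodule K V} (hUT : U ≤ T)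
    (hT : finrank K T = n) :
    {W : Submodule K V | U ≤ W ∧ W ≤ T ∧ finrank K W + 1 = n}.ncard =
      hyperplaneCount K n (finrank K U) := by
  obtain ⟨C', hC'⟩ := Submodule.exists_isCompl U
  set C := T ⊓ C' with hC
  have hsup : U ⊔ C = T := by
    rw [hC, inf_comm, ← sup_inf_assoc_of_le _ hUT, hC'.sup_eq_top, top_inf_eq]
  have hinf : U ⊓ C = ⊥ := by
    rw [eq_bot_iff, ← hC'.inf_eq_bot]; exact inf_le_inf_left _ inf_le_right
  have hdim := Submodule.finrank_sup_add_finrank_inf_eq U C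
  rw [hsup, hinf, finrank_bot, hT] at hdim
  have e : (Fin (n - finrank K U) → K) ≃ₗ[K] C :=
    LinearEquiv.ofFinrankEq _ _ (by rw [finrank_fin_fun]; omega)
  have hadd : ∀ X : Submodule K V, X ≤ C →
      finrank K (U ⊔ X : Submodule K V) = finrank K U + finrank K X := by
    intro X hX
    have h := Submodule.finrank_sup_add_finrank_inf_eq U X
    rw [eq_bot_iff.2 ((inf_le_inf_left U hX).trans hinf.le), finrank_bot] at h
    omega
  symm
  refine Set.ncard_congr
    (fun X _ => U ⊔ (X.map e.toLinearMap).map C.subtype) ?_ ?_ ?_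
  · intro X hX
    refine ⟨le_sup_left, ?_, ?_⟩
    · exact sup_le hUT ((Submodule.map_subtype_le _ _).trans inf_le_left)
    · have hX' : finrank K X + 1 = n - finrank K U := hX
      rw [hadd _ (Submodule.map_subtype_le _ _), Submodule.finrank_map_subtype_eq,
        LinearEquiv.finrank_map_eq e X]
      omega
  · intro X Y _ _ h
    have key : ∀ Z : Submodule K V, Z ≤ C → (U ⊔ Z) ⊓ C = Z := by
      intro Z hZ
      rw [sup_comm, sup_inf_assoc_of_le _ hZ, hinf, sup_bot_eq]
    have h2 := congrArg (· ⊓ C) h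
    simp only [key _ (Submodule.map_subtype_le _ _)] at h2
    have h3 := Submodule.map_injective_of_injective C.injective_subtype h2
    exact Submodule.map_injective_of_injective e.injective h3
  · rintro W ⟨hUW, hWT, hW⟩
    have hWC : U ⊔ (W ⊓ C) = W := by
      rw [inf_comm, ← sup_inf_assoc_of_le _ hUW, hsup, inf_eq_right.2 hWT]
    have hm : (((W ⊓ C).comap C.subtype).comap e.toLinearMap).map e.toLinearMap =
        (W ⊓ C).comap C.subtype :=
      Submodule.map_comap_eq_of_surjective e.surjective _
    have hm2 : ((W ⊓ C).comap C.subtype).map C.subtype = W ⊓ C := by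
      rw [Submodule.map_comap_subtype, inf_eq_right.2 inf_le_right]
    refine ⟨((W ⊓ C).comap C.subtype).comap e.toLinearMap, ?_, ?_⟩
    · have h1 := hadd (W ⊓ C) inf_le_right
      rw [hWC] at h1
      have h2 := LinearEquiv.finrank_map_eq e (((W ⊓ C).comap C.subtype).comap e.toLinearMap)
      have h3 := Submodule.finrank_map_subtype_eq C ((W ⊓ C).comap C.subtype)
      rw [hm] at h2
      rw [hm2] at h3
      show finrank K _ + 1 = _
      omega
    · simp only [hm, hm2, hWC]

/-- Cardinality of an affine hyperplane section: `f` takes the value `1` on a subspace `S` on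
which it does not vanish as often as it takes the value `0`. -/
theorem ncard_functional_eq_one [Finite K] (f : V →ₗ[K] K) (S : Submodule K V)
    {u : V} (hu : u ∈ S) (hfu : f u ≠ 0) :
    {w : V | w ∈ S ∧ f w = 1}.ncard =
      Nat.card K ^ finrank K (S ⊓ LinearMap.ker f : Submodule K V) := by
  rw [← natCard_eq_pow_finrank]
  change _ = Set.ncard ((S ⊓ LinearMap.ker f : Submodule K V) : Set V)
  refine Set.ncard_congr (fun w _ => w - (f u)⁻¹ • u) ?_ ?_ ?_
  · rintro w ⟨hw, hfw⟩
    exact ⟨S.sub_mem hw (S.smul_mem _ hu), by simp [hfw, hfu]⟩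
  · intro a b _ _ h
    exact sub_left_injective h
  · rintro w ⟨hw, hfw⟩
    rw [SetLike.mem_coe, LinearMap.mem_ker] at hfw
    exact ⟨w + (f u)⁻¹ • u, ⟨S.add_mem hw (S.smul_mem _ hu), by simp [hfw, hfu]⟩, by simp⟩

theorem finrank_inf_ker_add_one (f : V →ₗ[K] K) (S : Submodule K V)
    {u : V} (hu : u ∈ S) (hfu : f u ≠ 0) :
    finrank K (S ⊓ LinearMap.ker f : Submodule K V) + 1 = finrank K S := by
  have hnot : u ∉ S ⊓ LinearMap.ker f := fun h => hfu h.2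
  have : S ⊓ LinearMap.ker f ⊔ K ∙ u = S := by
    refine le_antisymm (sup_le inf_le_left (by simpa using hu)) fun w hw => ?_
    rw [Submodule.mem_sup]
    refine ⟨w - (f w / f u) • u, ⟨S.sub_mem hw (S.smul_mem _ hu), by simp [hfu]⟩,
      (f w / f u) • u, Submodule.smul_mem _ _ (Submodule.mem_span_singleton_self u), by simp⟩
  rw [← Submodule.finrank_sup_span_singleton hnot, this]

end Subspaces

/-! ### Polar geometries of reflexive sesquilinear forms -/

/-- The common framework for the three types of classical polar spaces: a reflexive sesquilinear
form `B`, which decides when two points are collinear, together with the set of vectors that are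
called singular. The field `ncard_singular_line` records that for a singular vector `v` each affine
line in direction `v` on which `B v` is `1` carries the same number `τ` of singular vectors. -/
structure PolarGeometry (K V : Type*) [Field K] [AddCommGroup V] [Module K V] where
  σ : K →+* K
  involutive : ∀ a, σ (σ a) = a
  B : V →ₛₗ[σ] V →ₗ[K] K
  refl : ∀ x y, B x y = 0 → B y x = 0
  Singular : V → Prop
  singular_add : ∀ x y, Singular x → Singular y → B x y = 0 → Singular (x + y)
  singular_smul : ∀ (a : K) x, Singular x → Singular (a • x)
  self_eq_zero : ∀ x, Singular x → B x x = 0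
  eq_zero_of_radical : ∀ x, Singular x → (∀ y, B x y = 0) → x = 0
  τ : ℕ
  ncard_singular_line : ∀ v w, Singular v → B v w = 1 → {t : K | Singular (w + t • v)}.ncard = τ

namespace PolarGeometry

variable {K V : Type*} [Field K] [AddCommGroup V] [Module K V]

/-- A subspace of the polar geometry: it consists of pairwise perpendicular singular vectors. -/
def IsTI (F : PolarGeometry K V) (S : Submodule K V) : Prop :=
  (∀ x ∈ S, F.Singular x) ∧ ∀ x ∈ S, ∀ y ∈ S, F.B x y = 0

/-- The perpendicular space of a subspace. -/
def perp (F : PolarGeometry K V) (W : Submodule K V) : Submodule K V where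
  carrier := {y | ∀ x ∈ W, F.B x y = 0}
  zero_mem' := fun x _ => map_zero _
  add_mem' := fun {a b} ha hb x hx => by rw [map_add, ha x hx, hb x hx, add_zero]
  smul_mem' := fun c a ha x hx => by rw [map_smul, ha x hx, smul_zero]

/-- A generator: a totally isotropic subspace of dimension `n`. -/
def IsGenerator (F : PolarGeometry K V) (n : ℕ) (S : Submodule K V) : Prop :=
  F.IsTI S ∧ finrank K S = n

variable {F : PolarGeometry K V}

theorem mem_perp {W : Submodule K V} {y : V} : y ∈ F.perp W ↔ ∀ x ∈ W, F.B x y = 0 := Iff.rfl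

theorem IsTI.mono {S T : Submodule K V} (hT : F.IsTI T) (h : S ≤ T) : F.IsTI S :=
  ⟨fun x hx => hT.1 x (h hx), fun x hx y hy => hT.2 x (h hx) y (h hy)⟩

theorem IsTI.sup {S T : Submodule K V} (hS : F.IsTI S) (hT : F.IsTI T) (h : T ≤ F.perp S) :
    F.IsTI (S ⊔ T) := by
  constructor
  · intro x hx
    obtain ⟨s, hs, t, ht, rfl⟩ := Submodule.mem_sup.1 hx
    exact F.singular_add _ _ (hS.1 s hs) (hT.1 t ht) (h ht s hs)
  · intro x hx y hy
    obtain ⟨s, hs, t, ht, rfl⟩ := Submodule.mem_sup.1 hx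
    obtain ⟨s', hs', t', ht', rfl⟩ := Submodule.mem_sup.1 hy
    simp only [map_add, LinearMap.add_apply]
    rw [hS.2 s hs s' hs', hT.2 t ht t' ht', h ht' s hs, F.refl _ _ (h ht s' hs')]
    simp

theorem isTI_span_singleton {v : V} (hv : F.Singular v) : F.IsTI (K ∙ v) := by
  constructor
  · intro x hx
    obtain ⟨a, rfl⟩ := Submodule.mem_span_singleton.1 hx
    exact F.singular_smul a v hv
  · intro x hx y hy
    obtain ⟨a, rfl⟩ := Submodule.mem_span_singleton.1 hx
    obtain ⟨b, rfl⟩ := Submodule.mem_span_singleton.1 hy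
    simp [F.self_eq_zero v hv]

theorem IsTI.sup_span {S : Submodule K V} (hS : F.IsTI S) {v : V} (hv : F.Singular v)
    (h : v ∈ F.perp S) : F.IsTI (S ⊔ K ∙ v) :=
  hS.sup (isTI_span_singleton hv) (by simpa using h)

section Dimension

variable [FiniteDimensional K V]

/-- The functionals `B x`, for `x` in a basis of `W`, cut out the perpendicular space of `W`. -/
theorem exists_linearMap_ker_eq_perp (F : PolarGeometry K V) (W : Submodule K V) :
    ∃ L : V →ₗ[K] (Fin (finrank K W) → K), LinearMap.ker L = F.perp W ∧
      ((∀ x ∈ W, (∀ y, F.B x y = 0) → x = 0) → LinearMap.range L = ⊤) := by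
  let b := finBasis K W
  refine ⟨LinearMap.pi fun i => F.B (b i : V), ?_, ?_⟩
  · ext y
    rw [LinearMap.mem_ker, mem_perp]
    constructor
    · intro h x hx
      have hsum := congrArg Subtype.val (b.sum_repr ⟨x, hx⟩)
      simp only [AddSubmonoidClass.coe_finsetSum, SetLike.val_smul] at hsum
      rw [← hsum, map_sum, LinearMap.sum_apply]
      refine Finset.sum_eq_zero fun i _ => ?_
      have hi : F.B (b i : V) y = 0 := congrFun h i
      simp [hi]
    · intro h
      funext i
      exact h _ (b i).2
  · intro hrad
    by_contra hne
    obtain ⟨f, hf0, hf⟩ := Submodule.exists_le_ker_of_lt_top _ (lt_top_iff_ne_top.2 hne)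
    -- A linear relation between the functionals is a vector of `W` in the radical.
    have hx := hrad (∑ i, F.σ (f (Pi.single i 1)) • (b i : V))
      (Submodule.sum_mem _ fun i _ => W.smul_mem _ (b i).2) (fun y => by
        have h : f (LinearMap.pi (fun i => F.B (b i : V)) y) = 0 := hf ⟨y, rfl⟩
        rw [LinearMap.pi_apply_eq_sum_univ f] at h
        rw [map_sum, LinearMap.sum_apply, ← h]
        refine Finset.sum_congr rfl fun i _ => ?_
        have hsingle : (Pi.single i 1 : Fin (finrank K W) → K) = fun j => if i = j then 1 else 0 := by
          ext j; simp [Pi.single_apply, eq_comm]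
        simp [F.involutive, mul_comm, hsingle])
    have hx' : ∑ i, F.σ (f (Pi.single i 1)) • b i = 0 := by
      apply Subtype.ext
      simpa using hx
    have h0 := Fintype.linearIndependent_iff.1 b.linearIndependent _ hx'
    apply hf0
    refine LinearMap.pi_ext' fun i => LinearMap.ext_ring ?_
    have := congrArg F.σ (h0 i)
    rw [F.involutive, map_zero] at this
    simpa using this

theorem finrank_perp_add (F : PolarGeometry K V) {W : Submodule K V} (hW : F.IsTI W) :
    finrank K (F.perp W) + finrank K W = finrank K V := by
  obtain ⟨L, hker, hrange⟩ := F.exists_linearMap_ker_eq_perp W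
  have h := L.finrank_range_add_finrank_ker
  rw [hrange fun x hx => F.eq_zero_of_radical x (hW.1 x hx), hker, finrank_top,
    finrank_fin_fun] at h
  omega

theorem finrank_le_finrank_inf_perp_add (F : PolarGeometry K V) (S W : Submodule K V) :
    finrank K S ≤ finrank K (S ⊓ F.perp W : Submodule K V) + finrank K W := by
  obtain ⟨L, hker, -⟩ := F.exists_linearMap_ker_eq_perp W
  have h := (L.domRestrict S).finrank_range_add_finrank_ker
  have h1 : finrank K (LinearMap.range (L.domRestrict S)) ≤ finrank K W := by
    simpa using Submodule.finrank_le (LinearMap.range (L.domRestrict S))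
  have h2 : (LinearMap.ker (L.domRestrict S)).map S.subtype = S ⊓ F.perp W := by
    rw [← hker, LinearMap.ker_domRestrict, Submodule.map_comap_subtype]
  rw [← h2, Submodule.finrank_map_subtype_eq]
  omega

end Dimension

/-- The polar geometry has rank `n`. -/
structure HasRank (F : PolarGeometry K V) (n : ℕ) : Prop where
  exists_isGenerator : ∃ S, F.IsGenerator n S
  finrank_le : ∀ S, F.IsTI S → finrank K S ≤ n

section Rank

variable [FiniteDimensional K V] {n : ℕ}

theorem HasRank.sup_span_eq (hF : F.HasRank n) {W T : Submodule K V} (hW : finrank K W + 1 = n)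
    (hT : F.IsTI T) (hWT : W ≤ T) {v : V} (hvT : v ∈ T) (hv : v ∉ W) : W ⊔ K ∙ v = T := by
  refine Submodule.eq_of_le_of_finrank_le (sup_le hWT (by simpa using hvT)) ?_
  rw [Submodule.finrank_sup_span_singleton hv, hW]
  exact hF.finrank_le T hT

/-- The near-polygon axiom: among the generators through an `(n - 1)`-space `W`, exactly one is
closer to a given generator `S` than the others. It is spanned by `W` and the part of `S` that is
perpendicular to `W`. -/
theorem HasRank.exists_nearest (hF : F.HasRank n) {S W : Submodule K V} (hS : F.IsGenerator n S)
    (hW : F.IsTI W) (hWn : finrank K W + 1 = n) :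
    ∃ T₀, F.IsGenerator n T₀ ∧ W ≤ T₀ ∧
      finrank K (S ⊓ T₀ : Submodule K V) = finrank K (S ⊓ W : Submodule K V) + 1 ∧
      ∀ T, F.IsGenerator n T → W ≤ T → T ≠ T₀ →
        finrank K (S ⊓ T : Submodule K V) = finrank K (S ⊓ W : Submodule K V) := by
  set U := S ⊓ F.perp W with hU
  have hTI : F.IsTI (W ⊔ U) := hW.sup (hS.1.mono inf_le_left) inf_le_right
  have hSWU : S ⊓ W = W ⊓ U := by
    refine le_antisymm (le_inf inf_le_right (le_inf inf_le_left fun x hx y hy => ?_))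
      (le_inf (inf_le_right.trans inf_le_left) inf_le_left)
    exact hW.2 y hy x hx.2
  -- Only a complement of `S ⊓ W` in `W` contributes conditions on vectors of `S`.
  have hlow : finrank K (S ⊓ W : Submodule K V) + 1 ≤ finrank K U := by
    obtain ⟨C', hC'⟩ := Submodule.exists_isCompl (S ⊓ W)
    have hsup : (S ⊓ W) ⊔ (W ⊓ C') = W := by
      rw [inf_comm W C', ← sup_inf_assoc_of_le _ inf_le_right, hC'.sup_eq_top, top_inf_eq]
    have hinf : (S ⊓ W) ⊓ (W ⊓ C') = ⊥ := by
      rw [eq_bot_iff, ← hC'.inf_eq_bot]; exact inf_le_inf_left _ inf_le_right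
    have hd := Submodule.finrank_sup_add_finrank_inf_eq (S ⊓ W) (W ⊓ C')
    rw [hsup, hinf, finrank_bot] at hd
    have hle : S ⊓ F.perp (W ⊓ C') ≤ U := by
      rintro y ⟨hyS, hy⟩
      refine ⟨hyS, fun x hx => ?_⟩
      rw [← hsup] at hx
      obtain ⟨a, ha, c, hc, rfl⟩ := Submodule.mem_sup.1 hx
      rw [map_add, LinearMap.add_apply, hS.1.2 a ha.1 y hyS, hy c hc, add_zero]
    have h1 := F.finrank_le_finrank_inf_perp_add S (W ⊓ C')
    have h2 := Submodule.finrank_mono hle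
    have h3 := hS.2
    omega
  have hdim := Submodule.finrank_sup_add_finrank_inf_eq W U
  rw [← hSWU] at hdim
  have hub := hF.finrank_le _ hTI
  have hgen : finrank K (W ⊔ U : Submodule K V) = n := by omega
  have hST₀ : S ⊓ (W ⊔ U) = U := by
    refine le_antisymm (fun x hx => ⟨hx.1, fun y hy => ?_⟩) (le_inf inf_le_left le_sup_right)
    exact hTI.2 y (Submodule.mem_sup_left hy) x hx.2
  refine ⟨W ⊔ U, ⟨hTI, hgen⟩, le_sup_left, by rw [hST₀]; omega, fun T hT hWT hne => ?_⟩
  have : S ⊓ T = S ⊓ W := by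
    refine le_antisymm (fun v hv => ⟨hv.1, ?_⟩) (inf_le_inf_left _ hWT)
    by_contra hvW
    have hvU : v ∈ U := ⟨hv.1, fun y hy => hT.1.2 y (hWT hy) v hv.2⟩
    exact hne ((hF.sup_span_eq hWn hT.1 hWT hv.2 hvW).symm.trans
      (hF.sup_span_eq hWn hTI le_sup_left (Submodule.mem_sup_right hvU) hvW))
  rw [this]

theorem HasRank.mem_of_mem_perp (hF : F.HasRank n) {S : Submodule K V} (hS : F.IsGenerator n S)
    {v : V} (hv : F.Singular v) (hvS : v ∈ F.perp S) : v ∈ S := by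
  by_contra h
  have h1 := hF.finrank_le _ (hS.1.sup_span hv hvS)
  rw [Submodule.finrank_sup_span_singleton h, hS.2] at h1
  omega

variable [Finite K]

/-- Counting the pairs formed by a vector `w` of `Wᗮ` with `B v w = 1` and a singular vector on the
line through `w` in direction `v`. -/
theorem ncard_singular_mul (F : PolarGeometry K V) {W : Submodule K V} {v : V}
    (hv : F.Singular v) (hvW : v ∈ F.perp W) :
    {w : V | w ∈ F.perp W ∧ F.Singular w ∧ F.B v w = 1}.ncard * Nat.card K =
      {w : V | w ∈ F.perp W ∧ F.B v w = 1}.ncard * F.τ := by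
  classical
  have : Finite V := Module.finite_of_finite K
  have := Fintype.ofFinite K
  have := Fintype.ofFinite V
  have hvv := F.self_eq_zero v hv
  have hL : ∑ w with w ∈ F.perp W ∧ F.B v w = 1,
      (Finset.univ.filter fun t : K => F.Singular (w + t • v)).card =
      {w : V | w ∈ F.perp W ∧ F.B v w = 1}.ncard * F.τ := by
    rw [Set.ncard_eq_toFinset_card', Set.toFinset_ofPred, ← smul_eq_mul, ← Finset.sum_const]
    refine Finset.sum_congr rfl fun w hw => ?_
    rw [← F.ncard_singular_line v w hv (Finset.mem_filter.1 hw).2.2, Set.ncard_eq_toFinset_card',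
      Set.toFinset_ofPred]
  rw [← hL, Nat.card_eq_fintype_card, Set.ncard_eq_toFinset_card', Set.toFinset_ofPred,
    ← Finset.card_univ, ← Finset.card_product, ← Finset.card_sigma]
  refine Finset.card_bij' (fun p _ => ⟨p.1 - p.2 • v, p.2⟩) (fun p _ => (p.1 + p.2 • v, p.2))
    ?_ ?_ ?_ ?_
  · rintro ⟨w, t⟩ h
    simp only [Finset.mem_product, Finset.mem_filter, Finset.mem_univ, true_and, and_true,
      Finset.mem_sigma] at h ⊢
    refine ⟨⟨Submodule.sub_mem _ h.1 (Submodule.smul_mem _ _ hvW), by simp [hvv, h.2.2]⟩, ?_⟩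
    simpa using h.2.1
  · rintro ⟨w, t⟩ h
    simp only [Finset.mem_product, Finset.mem_filter, Finset.mem_univ, true_and, and_true,
      Finset.mem_sigma] at h ⊢
    exact ⟨Submodule.add_mem _ h.1.1 (Submodule.smul_mem _ _ hvW), h.2, by simp [hvv, h.1.2]⟩
  · simp
  · simp

/-- In rank `n` and dimension `2 * n + δ`, every `(n - 1)`-space lies in exactly
`Q ^ δ * τ + 1` generators: each generator other than a fixed one `W ⊔ K ∙ v` contains
`Q ^ (n - 1)` of the singular vectors `w` of `Wᗮ` with `B v w = 1`. -/
theorem HasRank.ncard_generators (hF : F.HasRank n) {δ : ℕ} (hδ : finrank K V = 2 * n + δ)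
    {W : Submodule K V} (hW : F.IsTI W) (hWn : finrank K W + 1 = n) :
    {S : Submodule K V | F.IsGenerator n S ∧ W ≤ S}.ncard = Nat.card K ^ δ * F.τ + 1 := by
  classical
  have : Finite V := Module.finite_of_finite K
  have hK : 0 < Nat.card K := Nat.card_pos
  obtain ⟨S, hS⟩ := hF.exists_isGenerator
  obtain ⟨S₀, hS₀, hWS₀, -, -⟩ := hF.exists_nearest hS hW hWn
  obtain ⟨v, hvS₀, hvW⟩ : ∃ v ∈ S₀, v ∉ W := by
    by_contra! h
    have := Submodule.finrank_mono (show S₀ ≤ W from h)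
    have := hS₀.2
    omega
  have hv : F.Singular v := hS₀.1.1 v hvS₀
  have hvp : v ∈ F.perp W := fun x hx => hS₀.1.2 x (hWS₀ hx) v hvS₀
  have hspan := hF.sup_span_eq hWn hS₀.1 hWS₀ hvS₀ hvW
  set X := {w : V | w ∈ F.perp W ∧ F.Singular w ∧ F.B v w = 1} with hX
  set G := {S : Submodule K V | F.IsGenerator n S ∧ W ≤ S} with hG
  have hS₀G : S₀ ∈ G := ⟨hS₀, hWS₀⟩
  -- The number of vectors `w` of `Wᗮ` with `B v w = 1`.
  have hker : F.perp W ⊓ LinearMap.ker (F.B v) = F.perp S₀ := by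
    ext y
    constructor
    · rintro ⟨hy, hvy⟩ x hx
      rw [← hspan] at hx
      obtain ⟨a, ha, c, hc, rfl⟩ := Submodule.mem_sup.1 hx
      obtain ⟨t, rfl⟩ := Submodule.mem_span_singleton.1 hc
      have hvy' : F.B v y = 0 := hvy
      rw [map_add, LinearMap.add_apply, hy a ha]
      simp [hvy']
    · intro hy
      exact ⟨fun x hx => hy x (hWS₀ hx), hy v hvS₀⟩
  have hdW := F.finrank_perp_add hW
  have hdS := F.finrank_perp_add hS₀.1
  rw [hS₀.2] at hdS
  obtain ⟨u, hu, hvu⟩ : ∃ u ∈ F.perp W, F.B v u ≠ 0 := by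
    by_contra! h
    rw [inf_eq_left.2 fun y hy => h y hy] at hker
    rw [hker] at hdW
    omega
  have hY : {w : V | w ∈ F.perp W ∧ F.B v w = 1}.ncard = Nat.card K ^ (n + δ) := by
    rw [ncard_functional_eq_one (F.B v) _ hu hvu, hker]
    congr 1
    omega
  have hcount := F.ncard_singular_mul hv hvp
  rw [hY] at hcount
  -- Every generator other than `S₀` contains `Q ^ (n - 1)` vectors of `X`.
  have hfib : ∀ T ∈ G \ {S₀}, {w | w ∈ T ∧ F.B v w = 1}.ncard = Nat.card K ^ (n - 1) := by
    rintro T ⟨⟨hT, hWT⟩, hne⟩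
    obtain ⟨u, hu, hvu⟩ : ∃ u ∈ T, F.B v u ≠ 0 := by
      by_contra! h
      have hvT := hF.mem_of_mem_perp hT hv fun x hx => F.refl _ _ (h x hx)
      exact hne ((hF.sup_span_eq hWn hT.1 hWT hvT hvW).symm.trans hspan)
    rw [ncard_functional_eq_one (F.B v) T hu hvu]
    have := finrank_inf_ker_add_one (F.B v) T hu hvu
    rw [hT.2] at this
    congr 1
    omega
  have hXcard : X.ncard = (G \ {S₀}).ncard * Nat.card K ^ (n - 1) := by
    have := Fintype.ofFinite V
    have := Fintype.ofFinite (Submodule K V)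
    rw [Set.ncard_eq_toFinset_card' X, Set.ncard_eq_toFinset_card' (G \ {S₀}),
      Finset.card_eq_sum_card_fiberwise (f := fun w => W ⊔ K ∙ w) (t := (G \ {S₀}).toFinset),
      ← smul_eq_mul, ← Finset.sum_const]
    · refine Finset.sum_congr rfl fun T hT => ?_
      rw [Set.mem_toFinset] at hT
      rw [← hfib T hT, Set.ncard_eq_toFinset_card']
      congr 1
      ext w
      simp only [hX, Finset.mem_filter, Set.mem_toFinset, Set.mem_ofPred_eq]
      constructor
      · rintro ⟨⟨-, -, h⟩, rfl⟩
        exact ⟨Submodule.mem_sup_right (Submodule.mem_span_singleton_self w), h⟩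
      · rintro ⟨hw, h⟩
        refine ⟨⟨fun x hx => hT.1.1.1.2 x (hT.1.2 hx) w hw, hT.1.1.1.1 w hw, h⟩, ?_⟩
        refine hF.sup_span_eq hWn hT.1.1.1 hT.1.2 hw fun hwW => ?_
        rw [hS₀.1.2 v hvS₀ w (hWS₀ hwW)] at h
        exact zero_ne_one h
    · intro w hw
      simp only [Set.coe_toFinset] at hw ⊢
      obtain ⟨hwp, hws, hvw⟩ := hw
      have hwS₀ : w ∉ S₀ := fun h => zero_ne_one ((hS₀.1.2 v hvS₀ w h).symm.trans hvw)
      refine ⟨⟨⟨hW.sup_span hws hwp, ?_⟩, le_sup_left⟩, fun h => hwS₀ ?_⟩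
      · rw [Submodule.finrank_sup_span_singleton fun h => hwS₀ (hWS₀ h), hWn]
      · rw [← Set.mem_singleton_iff.1 h]
        exact Submodule.mem_sup_right (Submodule.mem_span_singleton_self w)
  have hGS : (G \ {S₀}).ncard = Nat.card K ^ δ * F.τ := by
    have hpow : Nat.card K ^ (n - 1) * Nat.card K = Nat.card K ^ n := by
      rw [← pow_succ]; congr 1; omega
    rw [hXcard, mul_assoc, hpow, pow_add] at hcount
    refine Nat.eq_of_mul_eq_mul_right (pow_pos hK n) ?_
    rw [hcount]; ring
  rw [← hGS]
  exact (Set.ncard_sdiff_singleton_add_one hS₀G (Set.toFinite _)).symm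

end Rank

end PolarGeometry

/-! ### A positive semidefinite kernel on the generators -/

namespace PolarGeometry

variable {K V : Type*} [Field K] [AddCommGroup V] [Module K V]

/-- The kernel `(-1 / s) ^ d`, with `d` the distance of two generators in the dual polar graph. -/
noncomputable def distKernel (n : ℕ) (s : ℝ) (S T : Submodule K V) : ℝ :=
  (-s⁻¹) ^ (n - finrank K (S ⊓ T : Submodule K V))

theorem distKernel_comm (n : ℕ) (s : ℝ) (S T : Submodule K V) :
    distKernel n s S T = distKernel n s T S := by
  rw [distKernel, distKernel, inf_comm]

variable [FiniteDimensional K V] [Finite K]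
  {F : PolarGeometry K V} {n : ℕ}

open scoped Classical in
/-- The finite set of generators. -/
noncomputable def generators (F : PolarGeometry K V) (n : ℕ) : Finset (Submodule K V) :=
  have : Finite V := Module.finite_of_finite K
  have := Fintype.ofFinite (Submodule K V)
  Finset.univ.filter (F.IsGenerator n)

open scoped Classical in
/-- The finite set of totally isotropic `(n - 1)`-spaces, the lines of the near polygon. -/
noncomputable def subgenerators (F : PolarGeometry K V) (n : ℕ) : Finset (Submodule K V) :=
  have : Finite V := Module.finite_of_finite K
  have := Fintype.ofFinite (Submodule K V)
  Finset.univ.filter fun W => F.IsTI W ∧ finrank K W + 1 = n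

theorem mem_generators {S : Submodule K V} : S ∈ F.generators n ↔ F.IsGenerator n S := by
  simp [generators]

theorem mem_subgenerators {W : Submodule K V} :
    W ∈ F.subgenerators n ↔ F.IsTI W ∧ finrank K W + 1 = n := by
  simp [subgenerators]

theorem IsGenerator.hyperplaneCount_pos {S : Submodule K V} (hS : F.IsGenerator n S) {k : ℕ}
    (hk : k < n) : 0 < hyperplaneCount K n k := by
  have : Finite V := Module.finite_of_finite K
  obtain ⟨W, hWS, hW⟩ := Submodule.exists_le_finrank_eq S (k := n - 1) (by have := hS.2; omega)
  obtain ⟨U, hUW, hU⟩ := Submodule.exists_le_finrank_eq W (k := k) (by omega)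
  rw [← hU, ← ncard_hyperplanes_containing (hUW.trans hWS) hS.2, Set.ncard_pos]
  exact ⟨W, hUW, hWS, by omega⟩

theorem IsGenerator.hyperplaneCount_le {S : Submodule K V} (hS : F.IsGenerator n S) {k : ℕ}
    (hk : k ≤ n) : hyperplaneCount K n k ≤ hyperplaneCount K n 0 := by
  have : Finite V := Module.finite_of_finite K
  obtain ⟨U, hUS, hU⟩ := Submodule.exists_le_finrank_eq S (k := k) (by have := hS.2; omega)
  have h0 := ncard_hyperplanes_containing (K := K) (bot_le : ⊥ ≤ S) hS.2
  rw [finrank_bot] at h0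
  rw [← h0, ← hU, ← ncard_hyperplanes_containing hUS hS.2]
  exact Set.ncard_le_ncard (fun W hW => ⟨bot_le, hW.2⟩) (Set.toFinite _)

open scoped Classical in
/-- The hyperplanes of the generator `T` that meet `S` in dimension `k`: if `S ⊓ T` has dimension
`k` these are the hyperplanes through `S ⊓ T`, if it has dimension `k + 1` the others. -/
theorem IsGenerator.card_subgenerators {T : Submodule K V} (hT : F.IsGenerator n T)
    (S : Submodule K V) (k : ℕ) :
    (((F.subgenerators n).filter fun W => finrank K (S ⊓ W : Submodule K V) = k ∧ W ≤ T).card : ℝ) =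
      (if finrank K (S ⊓ T : Submodule K V) = k then (hyperplaneCount K n k : ℝ) else 0) +
      (if finrank K (S ⊓ T : Submodule K V) = k + 1 then
        (hyperplaneCount K n 0 : ℝ) - hyperplaneCount K n (k + 1) else 0) := by
  have : Finite V := Module.finite_of_finite K
  rw [← Set.ncard_coe_finset]
  -- A hyperplane of `T` contains `S ⊓ T` or meets it in a hyperplane of `S ⊓ T`.
  have hdich : ∀ W ≤ T, finrank K W + 1 = n →
      (S ⊓ T ≤ W ∧ finrank K (S ⊓ W : Submodule K V) = finrank K (S ⊓ T : Submodule K V)) ∨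
      (¬ S ⊓ T ≤ W ∧ finrank K (S ⊓ W : Submodule K V) + 1 =
        finrank K (S ⊓ T : Submodule K V)) := by
    intro W hWT hW
    by_cases hle : S ⊓ T ≤ W
    · left
      refine ⟨hle, ?_⟩
      rw [le_antisymm (inf_le_inf_left S hWT) (le_inf inf_le_left hle)]
    · right
      refine ⟨hle, ?_⟩
      obtain ⟨v, hv, hvW⟩ := SetLike.not_le_iff_exists.1 hle
      have hsup : W ⊔ (S ⊓ T) = T := by
        refine Submodule.eq_of_le_of_finrank_le (sup_le hWT inf_le_right) ?_
        rw [hT.2, ← hW, ← Submodule.finrank_sup_span_singleton hvW]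
        exact Submodule.finrank_mono (sup_le_sup_left (by simpa using hv) _)
      have h := Submodule.finrank_sup_add_finrank_inf_eq W (S ⊓ T)
      have hinf : W ⊓ (S ⊓ T) = S ⊓ W := by
        rw [inf_left_comm, inf_eq_left.2 hWT]
      rw [hsup, hinf, hT.2] at h
      omega
  have hcount := ncard_hyperplanes_containing (K := K) (inf_le_right : S ⊓ T ≤ T) hT.2
  have hall := ncard_hyperplanes_containing (K := K) (bot_le : ⊥ ≤ T) hT.2
  rw [finrank_bot] at hall
  by_cases h1 : finrank K (S ⊓ T : Submodule K V) = k
  · rw [if_pos h1, if_neg (by omega), add_zero, ← h1, ← hcount]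
    congr 2
    ext W
    simp only [Finset.coe_filter, mem_subgenerators, Set.mem_ofPred_eq]
    constructor
    · rintro ⟨⟨-, hW⟩, hk, hWT⟩
      rcases hdich W hWT hW with h | h
      · exact ⟨h.1, hWT, hW⟩
      · omega
    · rintro ⟨hSW, hWT, hW⟩
      rcases hdich W hWT hW with h | h
      · exact ⟨⟨hT.1.mono hWT, hW⟩, h.2, hWT⟩
      · exact absurd hSW h.1
  · rw [if_neg h1, zero_add]
    by_cases h2 : finrank K (S ⊓ T : Submodule K V) = k + 1
    · rw [if_pos h2, ← h2, ← hcount, ← hall, eq_sub_iff_add_eq, ← Nat.cast_add,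
        ← Set.ncard_union_eq]
      · congr 2
        ext W
        simp only [Finset.coe_filter, mem_subgenerators, Set.mem_ofPred_eq, Set.mem_union]
        constructor
        · rintro (⟨⟨-, hW⟩, -, hWT⟩ | ⟨-, hWT, hW⟩) <;> exact ⟨bot_le, hWT, hW⟩
        · rintro ⟨-, hWT, hW⟩
          rcases hdich W hWT hW with h | h
          · exact Or.inr ⟨h.1, hWT, hW⟩
          · exact Or.inl ⟨⟨hT.1.mono hWT, hW⟩, by omega, hWT⟩
      · rw [Set.disjoint_left]
        intro W hW hW'
        simp only [Finset.coe_filter, mem_subgenerators, Set.mem_ofPred_eq] at hW hW'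
        rcases hdich W hW'.2.1 hW'.2.2 with h | h
        · omega
        · exact h.1 hW'.1
    · rw [if_neg h2, Nat.cast_eq_zero, Set.ncard_eq_zero]
      ext W
      simp only [Finset.coe_filter, mem_subgenerators, Set.mem_ofPred_eq, Set.mem_empty_iff_false,
        iff_false]
      rintro ⟨⟨-, hW⟩, hk, hWT⟩
      rcases hdich W hWT hW with h | h <;> omega

open scoped Classical in
/-- Functions on the generators whose sum over the generators through every `(n - 1)`-space is
zero. They form an eigenspace of the dual polar graph, the one of its least eigenvalue. -/
def LineSumZero (F : PolarGeometry K V) (n : ℕ) (g : Submodule K V → ℝ) : Prop :=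
  ∀ W ∈ F.subgenerators n, ∑ T ∈ F.generators n with W ≤ T, g T = 0

open scoped Classical in
/-- The sum of `g` over the generators that meet `S` in dimension `k`. -/
noncomputable def sphereSum (F : PolarGeometry K V) (n : ℕ) (S : Submodule K V)
    (g : Submodule K V → ℝ) (k : ℕ) : ℝ :=
  ∑ T ∈ F.generators n with finrank K (S ⊓ T : Submodule K V) = k, g T

/-- Adding up the line sums over all `(n - 1)`-spaces that meet `S` in dimension `k`. -/
theorem LineSumZero.sphereSum_recursion {g : Submodule K V → ℝ} (hg : F.LineSumZero n g)
    (S : Submodule K V) (k : ℕ) :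
    (hyperplaneCount K n k : ℝ) * F.sphereSum n S g k +
      ((hyperplaneCount K n 0 : ℝ) - hyperplaneCount K n (k + 1)) *
        F.sphereSum n S g (k + 1) = 0 := by
  classical
  have h0 : ∑ W ∈ F.subgenerators n with finrank K (S ⊓ W : Submodule K V) = k,
      ∑ T ∈ F.generators n with W ≤ T, g T = 0 :=
    Finset.sum_eq_zero fun W hW => hg W (Finset.mem_filter.1 hW).1
  rw [Finset.sum_comm' (t' := F.generators n) (s' := fun T => (F.subgenerators n).filter fun W =>
    finrank K (S ⊓ W : Submodule K V) = k ∧ W ≤ T)] at h0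
  · rw [← h0, sphereSum, sphereSum, Finset.mul_sum, Finset.mul_sum, Finset.sum_filter,
      Finset.sum_filter, ← Finset.sum_add_distrib]
    refine Finset.sum_congr rfl fun T hT => ?_
    rw [Finset.sum_const, nsmul_eq_mul, (mem_generators.1 hT).card_subgenerators S k, add_mul,
      ite_mul, ite_mul, zero_mul]
  · intro W T
    simp only [Finset.mem_filter]
    tauto

/-- Absolute values of the eigenvalues of the distance-`i` relations on `LineSumZero` functions. -/
noncomputable def sphereCoeff (K : Type*) [Field K] (n : ℕ) : ℕ → ℝ
  | 0 => 1
  | i + 1 => ((hyperplaneCount K n 0 : ℝ) - hyperplaneCount K n (n - i)) /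
      hyperplaneCount K n (n - (i + 1)) * sphereCoeff K n i

theorem IsGenerator.sphereCoeff_nonneg {S : Submodule K V} (hS : F.IsGenerator n S) (i : ℕ) :
    0 ≤ sphereCoeff K n i := by
  induction i with
  | zero => exact zero_le_one
  | succ i ih =>
    have := hS.hyperplaneCount_le (Nat.sub_le n i)
    exact mul_nonneg (div_nonneg (sub_nonneg.2 (by exact_mod_cast this)) (Nat.cast_nonneg _)) ih

theorem LineSumZero.sphereSum_eq {g : Submodule K V → ℝ} (hg : F.LineSumZero n g)
    {S : Submodule K V} (hS : F.IsGenerator n S) {i : ℕ} (hi : i ≤ n) :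
    F.sphereSum n S g (n - i) = (-1) ^ i * sphereCoeff K n i * g S := by
  classical
  induction i with
  | zero =>
    have : (F.generators n).filter (fun T => finrank K (S ⊓ T : Submodule K V) = n - 0) = {S} := by
      ext T
      simp only [Finset.mem_filter, mem_generators, Finset.mem_singleton, Nat.sub_zero]
      constructor
      · rintro ⟨hT, h⟩
        have h1 := Submodule.eq_of_le_of_finrank_eq (inf_le_left : S ⊓ T ≤ S) (h.trans hS.2.symm)
        have h2 := Submodule.eq_of_le_of_finrank_eq (inf_le_right : S ⊓ T ≤ T) (h.trans hT.2.symm)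
        exact h2.symm.trans h1
      · rintro rfl
        exact ⟨hS, by rw [inf_idem, hS.2]⟩
    rw [sphereSum, this]
    simp [sphereCoeff]
  | succ i ih =>
    have h := hg.sphereSum_recursion S (n - (i + 1))
    rw [show n - (i + 1) + 1 = n - i by omega, ih (by omega)] at h
    have hpos : (0 : ℝ) < hyperplaneCount K n (n - (i + 1)) := by
      exact_mod_cast hS.hyperplaneCount_pos (by omega)
    rw [sphereCoeff, pow_succ]
    field_simp
    linear_combination h

/-- On a line with `s + 1` points, one is at distance `d` and `s` are at distance `d + 1`, and
`1 + s * (-1 / s) = 0`. -/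
theorem HasRank.lineSumZero_distKernel (hF : F.HasRank n) {s : ℝ} (hs : 0 < s)
    (hline : ∀ W : Submodule K V, F.IsTI W → finrank K W + 1 = n →
      ({S : Submodule K V | F.IsGenerator n S ∧ W ≤ S}.ncard : ℝ) = s + 1)
    {S : Submodule K V} (hS : F.IsGenerator n S) : F.LineSumZero n (distKernel n s S) := by
  classical
  intro W hW
  obtain ⟨hW, hWn⟩ := mem_subgenerators.1 hW
  obtain ⟨T₀, hT₀, hWT₀, hd, hne⟩ := hF.exists_nearest hS hW hWn
  have hmem : T₀ ∈ (F.generators n).filter (W ≤ ·) := by simp [mem_generators, hT₀, hWT₀]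
  have hcard := hline W hW hWn
  rw [show {S : Submodule K V | F.IsGenerator n S ∧ W ≤ S} =
    ((F.generators n).filter (W ≤ ·) : Set (Submodule K V)) by ext; simp [mem_generators],
    Set.ncard_coe_finset, ← Finset.card_erase_add_one hmem] at hcard
  push_cast at hcard
  have hle : finrank K (S ⊓ W : Submodule K V) + 1 ≤ n := by
    rw [← hWn]
    exact Nat.succ_le_succ (Submodule.finrank_mono inf_le_right)
  rw [← Finset.add_sum_erase _ _ hmem, Finset.sum_congr rfl fun T hT => show distKernel n s S T =
    (-s⁻¹) ^ (n - finrank K (S ⊓ W : Submodule K V)) by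
      simp only [Finset.mem_erase, Finset.mem_filter, mem_generators] at hT
      rw [distKernel, hne T hT.2.1 hT.2.2 hT.1]]
  rw [Finset.sum_const, nsmul_eq_mul, add_right_cancel hcard, distKernel, hd,
    show n - finrank K (S ⊓ W : Submodule K V) =
      n - (finrank K (S ⊓ W : Submodule K V) + 1) + 1 by omega, pow_succ]
  field_simp
  ring

/-- The kernel reproduces `LineSumZero` functions up to a positive factor. -/
theorem LineSumZero.sum_distKernel_mul {g : Submodule K V → ℝ} (hg : F.LineSumZero n g) (s : ℝ)
    {S : Submodule K V} (hS : F.IsGenerator n S) :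
    ∑ T ∈ F.generators n, distKernel n s S T * g T =
      (∑ i ∈ Finset.range (n + 1), s⁻¹ ^ i * sphereCoeff K n i) * g S := by
  classical
  rw [← Finset.sum_fiberwise_of_maps_to (t := Finset.range (n + 1))
    (g := fun T : Submodule K V => n - finrank K (S ⊓ T : Submodule K V))
    (fun T _ => Finset.mem_range.2 (by omega)), Finset.sum_mul]
  refine Finset.sum_congr rfl fun i hi => ?_
  have hi' : i ≤ n := Nat.lt_succ_iff.1 (Finset.mem_range.1 hi)
  have hfil : (F.generators n).filter (fun T => n - finrank K (S ⊓ T : Submodule K V) = i) =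
      (F.generators n).filter (fun T => finrank K (S ⊓ T : Submodule K V) = n - i) := by
    refine Finset.filter_congr fun T _ => ?_
    have : finrank K (S ⊓ T : Submodule K V) ≤ n := by
      rw [← hS.2]; exact Submodule.finrank_mono inf_le_left
    omega
  have h := hg.sphereSum_eq hS hi'
  rw [sphereSum] at h
  have hsign : (-s⁻¹) ^ i = (-1) ^ i * s⁻¹ ^ i := by rw [← mul_pow]; simp
  have hsq : ((-1 : ℝ) ^ i) * (-1) ^ i = 1 := by rw [← mul_pow]; simp
  rw [Finset.sum_congr rfl fun T hT => show distKernel n s S T * g T = (-s⁻¹) ^ i * g T by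
    rw [distKernel, (Finset.mem_filter.1 hT).2], ← Finset.mul_sum, hfil, h, hsign]
  linear_combination s⁻¹ ^ i * sphereCoeff K n i * g S * hsq

/-- The kernel is positive semidefinite: it is symmetric and its square is a positive multiple of
itself. -/
theorem HasRank.sum_distKernel_nonneg (hF : F.HasRank n) {s : ℝ} (hs : 0 < s)
    (hline : ∀ W : Submodule K V, F.IsTI W → finrank K W + 1 = n →
      ({S : Submodule K V | F.IsGenerator n S ∧ W ≤ S}.ncard : ℝ) = s + 1)
    (D : Finset (Submodule K V)) (hD : ∀ S ∈ D, F.IsGenerator n S) :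
    0 ≤ ∑ S ∈ D, ∑ T ∈ D, distKernel n s S T := by
  obtain ⟨S₀, hS₀⟩ := hF.exists_isGenerator
  set c := ∑ i ∈ Finset.range (n + 1), s⁻¹ ^ i * sphereCoeff K n i with hc
  have hc0 : 0 < c := by
    refine Finset.sum_pos' (fun i _ => mul_nonneg (by positivity) (hS₀.sphereCoeff_nonneg i))
      ⟨0, by simp, by simp [sphereCoeff]⟩
  have hsq : c * ∑ S ∈ D, ∑ T ∈ D, distKernel n s S T =
      ∑ R ∈ F.generators n, (∑ S ∈ D, distKernel n s S R) ^ 2 := by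
    simp_rw [sq, Finset.sum_mul_sum, Finset.mul_sum]
    symm
    rw [Finset.sum_comm]
    refine Finset.sum_congr rfl fun S hS => ?_
    rw [Finset.sum_comm]
    refine Finset.sum_congr rfl fun T hT => ?_
    rw [distKernel_comm n s S T, ← (hF.lineSumZero_distKernel hs hline (hD T hT)).sum_distKernel_mul s
      (hD S hS)]
  refine nonneg_of_mul_nonneg_right ?_ hc0
  rw [hsq]
  exact Finset.sum_nonneg fun R _ => sq_nonneg _

/-- The bound: the kernel is `1` on the diagonal and `-s ^ (-(n - 1))` on pairs of generators that
meet in a point, because `n - 1` is odd. -/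
theorem HasRank.ncard_le (hF : F.HasRank n) (hn : Even n) (hn0 : n ≠ 0) {s : ℝ} (hs : 0 < s)
    (hline : ∀ W : Submodule K V, F.IsTI W → finrank K W + 1 = n →
      ({S : Submodule K V | F.IsGenerator n S ∧ W ≤ S}.ncard : ℝ) = s + 1)
    (D : Set (Submodule K V)) (hD : ∀ S ∈ D, F.IsGenerator n S)
    (hpair : ∀ S ∈ D, ∀ T ∈ D, S ≠ T → finrank K (S ⊓ T : Submodule K V) = 1) :
    (D.ncard : ℝ) ≤ s ^ (n - 1) + 1 := by
  classical
  have : Finite V := Module.finite_of_finite K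
  have hfin : D.Finite := Set.toFinite D
  have hmem : ∀ S, S ∈ hfin.toFinset ↔ S ∈ D := fun S => hfin.mem_toFinset
  have hpos := hF.sum_distKernel_nonneg hs hline hfin.toFinset fun S hS => hD S ((hmem S).1 hS)
  have hodd : Odd (n - 1) := by
    obtain ⟨m, rfl⟩ := hn
    exact ⟨m - 1, by omega⟩
  rw [Set.ncard_eq_toFinset_card D hfin]
  set E := hfin.toFinset with hE
  rcases E.eq_empty_or_nonempty with h | hne
  · rw [h]; simp; positivity
  have hrow : ∀ S ∈ E, ∑ T ∈ E, distKernel n s S T = 1 - ((E.card : ℝ) - 1) * (s ^ (n - 1))⁻¹ := by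
    intro S hS
    have hSD := (hmem S).1 hS
    rw [← Finset.add_sum_erase _ _ hS, Finset.sum_congr rfl fun T hT => show
      distKernel n s S T = -(s ^ (n - 1))⁻¹ by
        rw [Finset.mem_erase] at hT
        rw [distKernel, hpair S hSD T ((hmem T).1 hT.2) hT.1.symm, hodd.neg_pow, inv_pow]]
    rw [Finset.sum_const, nsmul_eq_mul, Finset.card_erase_of_mem hS,
      Nat.cast_sub (Finset.card_pos.2 hne), distKernel, inf_idem, (hD S hSD).2]
    simp
    ring
  rw [Finset.sum_congr rfl hrow, Finset.sum_const, nsmul_eq_mul] at hpos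
  have hc : (0 : ℝ) < E.card := by exact_mod_cast Finset.card_pos.2 hne
  have h1 := nonneg_of_mul_nonneg_right hpos hc
  have hsp : (0 : ℝ) < s ^ (n - 1) := by positivity
  rw [sub_nonneg, ← div_eq_mul_inv, div_le_one hsp] at h1
  linarith

end PolarGeometry

/-! ### Involutions of finite fields -/

section Involution

variable {K : Type*} [Field K] {σ : K →+* K}

/-- For an involution `σ`, the fibres of the trace map `t ↦ t + σ t` over fixed elements of `σ` are
translates of its kernel. -/
theorem ncard_trace_fibre (hσ : ∀ a, σ (σ a) = a) (hne : σ ≠ RingHom.id K) {c : K}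
    (hc : σ c = c) : {t : K | c + t + σ t = 0}.ncard = {t : K | t + σ t = 0}.ncard := by
  obtain ⟨u, hu⟩ : ∃ u, u + σ u ≠ 0 := by
    by_contra! h
    refine hne (RingHom.ext fun x => ?_)
    have h1 : (1 : K) + 1 = 0 := by simpa using h 1
    rw [RingHom.id_apply]
    linear_combination h x - x * h1
  have hfix : σ (u + σ u) = u + σ u := by rw [map_add, hσ, add_comm]
  -- `t₀` has trace `c`.
  set t₀ := c / (u + σ u) * u with ht₀
  have htr : t₀ + σ t₀ = c := by
    rw [ht₀, map_mul, map_div₀, hc, hfix, ← mul_add, div_mul_cancel₀ _ hu]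
  refine Set.ncard_congr (fun t _ => t + t₀) ?_ (fun a b _ _ h => add_right_cancel h) ?_
  · intro t ht
    have ht' : c + t + σ t = 0 := ht
    show t + t₀ + σ (t + t₀) = 0
    rw [map_add]
    linear_combination ht' + htr
  · intro t ht
    have ht' : t + σ t = 0 := ht
    refine ⟨t - t₀, ?_, by ring⟩
    show c + (t - t₀) + σ (t - t₀) = 0
    rw [map_sub]
    linear_combination ht' - htr

/-- The kernel of the trace map of an involution of a field with `q ^ 2` elements has `q`
elements. -/
theorem ncard_trace_ker (hσ : ∀ a, σ (σ a) = a) (hne : σ ≠ RingHom.id K) {q : ℕ}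
    (hq : Nat.card K = q ^ 2) : {t : K | t + σ t = 0}.ncard = q := by
  obtain ⟨u, hu⟩ : ∃ u, u - σ u ≠ 0 := by
    by_contra! h
    exact hne (RingHom.ext fun x => (sub_eq_zero.1 (h x)).symm)
  have hδ : σ (u - σ u) = -(u - σ u) := by rw [map_sub, hσ, neg_sub]
  -- Multiplication by `u - σ u` maps the fixed field onto the kernel of the trace.
  have h1 : {t : K | σ t = t}.ncard = {t : K | t + σ t = 0}.ncard := by
    refine Set.ncard_congr (fun t _ => t * (u - σ u)) ?_
      (fun a b _ _ h => mul_right_cancel₀ hu h) ?_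
    · intro t ht
      have ht' : σ t = t := ht
      show t * (u - σ u) + σ (t * (u - σ u)) = 0
      rw [map_mul, hδ, ht']
      ring
    · intro t ht
      have ht' : t + σ t = 0 := ht
      refine ⟨t / (u - σ u), ?_, div_mul_cancel₀ _ hu⟩
      show σ (t / (u - σ u)) = t / (u - σ u)
      rw [map_div₀, hδ, div_neg, ← neg_div]
      congr 1
      linear_combination -ht'
  -- The elements `1` and `u` form a basis of the field over the fixed field.
  have h2 : Nat.card K = {t : K | σ t = t}.ncard ^ 2 := by
    rw [← Nat.card_coe_set_eq, sq, ← Nat.card_prod]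
    symm
    refine Nat.card_eq_of_bijective
      (fun p : {t : K | σ t = t} × {t : K | σ t = t} => (p.1 : K) + p.2 * u) ⟨?_, ?_⟩
    · rintro ⟨⟨a, ha⟩, ⟨b, hb⟩⟩ ⟨⟨a', ha'⟩, ⟨b', hb'⟩⟩ h
      replace ha : σ a = a := ha
      replace hb : σ b = b := hb
      replace ha' : σ a' = a' := ha'
      replace hb' : σ b' = b' := hb'
      replace h : a + b * u = a' + b' * u := h
      have hs := congrArg σ h
      simp only [map_add, map_mul, ha, hb, ha', hb'] at hs
      have hbb : b = b' := by
        refine mul_right_cancel₀ hu ?_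
        linear_combination h - hs
      subst hbb
      simpa using h
    · intro x
      set b := (x - σ x) / (u - σ u) with hb
      have hbu : b * (u - σ u) = x - σ x := div_mul_cancel₀ _ hu
      have hbfix : σ b = b := by
        rw [hb, map_div₀, hδ, map_sub, hσ, div_neg, ← neg_div, neg_sub]
      refine ⟨(⟨x - b * u, ?_⟩, ⟨b, hbfix⟩), by simp⟩
      show σ (x - b * u) = x - b * u
      rw [map_sub, map_mul, hbfix]
      linear_combination hbu
  rw [← h1]
  rw [hq] at h2
  exact (Nat.pow_left_injective (two_ne_zero) h2).symm

end Involution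

/-! ### The classical polar spaces as polar geometries -/

namespace PolarGeometry

variable {K V : Type*} [Field K] [AddCommGroup V] [Module K V]

/-- The polar geometry of a quadratic form, with the polar form as its bilinear form. On a line
through `v` the quadratic form is affine with slope `B v w = 1`, so `τ = 1`. -/
def ofQuadratic (Q : QuadraticForm K V) (h : Q.Nondegenerate) : PolarGeometry K V where
  σ := RingHom.id K
  involutive := fun _ => rfl
  B := Q.polarBilin
  refl := fun x y hxy => by
    rw [QuadraticMap.polarBilin_apply_apply] at hxy ⊢
    rw [QuadraticMap.polar_comm, hxy]
  Singular := fun x => Q x = 0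
  singular_add := fun x y hx hy hxy => by
    rw [QuadraticMap.polarBilin_apply_apply] at hxy
    rw [QuadraticMap.map_add Q, hx, hy, hxy, add_zero, add_zero]
  singular_smul := fun a x hx => by rw [QuadraticMap.map_smul, hx, smul_zero]
  self_eq_zero := fun x hx => by
    rw [QuadraticMap.polarBilin_apply_apply, QuadraticMap.polar_self, hx, smul_zero]
  eq_zero_of_radical := fun x hx hy => by
    have : x ∈ Q.radical := ⟨hx, LinearMap.ext hy⟩
    rwa [h.radical_eq_bot, Submodule.mem_bot] at this
  τ := 1
  ncard_singular_line := fun v w hv hvw => by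
    rw [QuadraticMap.polarBilin_apply_apply] at hvw
    rw [Set.ncard_eq_one]
    refine ⟨-Q w, ?_⟩
    ext t
    rw [Set.mem_ofPred_eq, Set.mem_singleton_iff, QuadraticMap.map_add Q, QuadraticMap.map_smul, hv,
      QuadraticMap.polar_smul_right, QuadraticMap.polar_comm, hvw, smul_zero, add_zero, smul_eq_mul,
      mul_one, eq_neg_iff_add_eq_zero, add_comm]

/-- The polar geometry of an alternating form: every vector is singular, so `τ = |K|`. -/
noncomputable def ofSymplectic (B : V →ₗ[K] V →ₗ[K] K) (alt : B.IsAlt) (h : B.Nondegenerate) :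
    PolarGeometry K V where
  σ := RingHom.id K
  involutive := fun _ => rfl
  B := B
  refl := fun x y hxy => by rw [← alt.neg, hxy, neg_zero]
  Singular := fun _ => True
  singular_add := fun _ _ _ _ _ => trivial
  singular_smul := fun _ _ _ => trivial
  self_eq_zero := fun x _ => alt x
  eq_zero_of_radical := fun x _ hx => h.1 x hx
  τ := Nat.card K
  ncard_singular_line := fun _ _ _ _ => Set.ncard_univ K

/-- The polar geometry of a Hermitian form. On a line through `v` the condition on the parameter
`t` prescribes its trace `t + σ t`. -/
noncomputable def ofHermitian (σ : K →+* K) (hσ : ∀ a, σ (σ a) = a) (hne : σ ≠ RingHom.id K)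
    (B : V →ₛₗ[σ] V →ₗ[K] K) (herm : ∀ x y, σ (B x y) = B y x) (h : B.Nondegenerate) :
    PolarGeometry K V where
  σ := σ
  involutive := hσ
  B := B
  refl := fun x y hxy => by rw [← herm, hxy, map_zero]
  Singular := fun x => B x x = 0
  singular_add := fun x y hx hy hxy => by
    have hyx : B y x = 0 := by rw [← herm, hxy, map_zero]
    simp [hx, hy, hxy, hyx]
  singular_smul := fun a x hx => by simp [hx]
  self_eq_zero := fun _ hx => hx
  eq_zero_of_radical := fun x _ hx => h.1 x hx
  τ := {t : K | t + σ t = 0}.ncard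
  ncard_singular_line := fun v w hv hvw => by
    have hwv : B w v = 1 := by rw [← herm, hvw, map_one]
    rw [← ncard_trace_fibre hσ hne (herm w w)]
    congr 1
    ext t
    simp [hv, hvw, hwv, add_comm, add_left_comm]

end PolarGeometry

namespace ClassicalPolarSpace

variable {K V : Type*} [Field K] [AddCommGroup V] [Module K V]

/-- The polar geometry of a classical polar space. -/
noncomputable def toPolarGeometry : ClassicalPolarSpace K V → PolarGeometry K V
  | quadratic Q h => .ofQuadratic Q h
  | symplectic B alt h => .ofSymplectic B alt h
  | hermitian σ hσ hne B herm h => .ofHermitian σ hσ hne B herm h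

theorem isTI_toPolarGeometry (P : ClassicalPolarSpace K V) (S : Submodule K V) :
    P.toPolarGeometry.IsTI S ↔ P.IsTotallyIsotropic S := by
  cases P with
  | quadratic Q h =>
    refine ⟨fun hS => hS.1, fun hS => ⟨hS, fun x hx y hy => ?_⟩⟩
    show Q.polarBilin x y = 0
    rw [QuadraticMap.polarBilin_apply_apply, QuadraticMap.polar, hS _ (S.add_mem hx hy), hS x hx,
      hS y hy, sub_zero, sub_zero]
  | symplectic B alt h => exact ⟨fun hS => hS.2, fun hS => ⟨fun _ _ => trivial, hS⟩⟩
  | hermitian σ hσ hne B herm h => exact ⟨fun hS => hS.2, fun hS => ⟨fun x hx => hS x hx x hx, hS⟩⟩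

theorem isGenerator_toPolarGeometry (P : ClassicalPolarSpace K V) (n : ℕ) (S : Submodule K V) :
    P.toPolarGeometry.IsGenerator n S ↔ P.IsSpace n S :=
  and_congr_left' (P.isTI_toPolarGeometry S)

theorem HasRank.toPolarGeometry {P : ClassicalPolarSpace K V} {n : ℕ} (h : P.HasRank n) :
    P.toPolarGeometry.HasRank n where
  exists_isGenerator :=
    let ⟨S, hS⟩ := h.1
    ⟨S, (P.isGenerator_toPolarGeometry n S).2 hS⟩
  finrank_le := fun S hS => h.2 ⟨S, (P.isTI_toPolarGeometry S).1 hS, rfl⟩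

theorem IsOrthogonal.τ_eq {P : ClassicalPolarSpace K V} (h : P.IsOrthogonal) :
    P.toPolarGeometry.τ = 1 := by
  cases P with
  | quadratic => rfl
  | symplectic => exact h.elim
  | hermitian => exact h.elim

theorem IsSymplectic.τ_eq {P : ClassicalPolarSpace K V} (h : P.IsSymplectic) :
    P.toPolarGeometry.τ = Nat.card K := by
  cases P with
  | quadratic => exact h.elim
  | symplectic => rfl
  | hermitian => exact h.elim

theorem IsHermitian.τ_eq {P : ClassicalPolarSpace K V} (h : P.IsHermitian) {q : ℕ}
    (hq : Nat.card K = q ^ 2) : P.toPolarGeometry.τ = q := by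
  cases P with
  | quadratic => exact h.elim
  | symplectic => exact h.elim
  | hermitian σ hσ hne B herm hB => exact ncard_trace_ker hσ hne hq

end ClassicalPolarSpace

/-! ### Dual arcs and constant-distance codes -/

section Codes

variable {K V : Type*} [Field K] [AddCommGroup V] [Module K V] [FiniteDimensional K V]

theorem IsConstantDistanceCode.finrank_inf {n : ℕ} (hn : n ≠ 0) {D : Set (Submodule K V)}
    (hD : IsConstantDistanceCode n (2 * (n - 1)) D) {S T : Submodule K V} (hS : S ∈ D) (hT : T ∈ D)
    (hne : S ≠ T) : finrank K (S ⊓ T : Submodule K V) = 1 := by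
  have h := hD.dist_eq S hS T hT hne
  have hd := Submodule.finrank_sup_add_finrank_inf_eq S T
  have hle := Submodule.finrank_mono (inf_le_left : S ⊓ T ≤ S)
  rw [hD.finrank_eq S hS, hD.finrank_eq T hT] at hd
  rw [hD.finrank_eq S hS] at hle
  rw [subspaceDist] at h
  omega

end Codes

theorem theorem2 {K V : Type*} [Field K] [Finite K] [AddCommGroup V] [Module K V]
    [FiniteDimensional K V] (P : ClassicalPolarSpace K V) (n : ℕ) (hrank : P.HasRank n)
    (hn : Even n) (D : Set (Submodule K V)) (hDP : ∀ S ∈ D, P.IsSpace n S)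
    (hD : IsDualArc n D ∨ IsConstantDistanceCode n (2 * (n - 1)) D) :
    (∀ e : ℝ, P.HasParameters n e →
      (D.ncard : ℝ) ≤ (Nat.card K : ℝ) ^ (((n : ℝ) - 1) * e) + 1) ∧
    (P.IsHyperbolicQuadric n → D.ncard ≤ 2) ∧
    (P.IsParabolicQuadric n → D.ncard ≤ Nat.card K ^ (n - 1) + 1) ∧
    (P.IsEllipticQuadric n → D.ncard ≤ Nat.card K ^ (2 * n - 2) + 1) ∧
    (P.IsSymplecticSpace n → D.ncard ≤ Nat.card K ^ (n - 1) + 1) ∧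
    (P.IsEvenHermitianVariety n → ∀ q : ℕ, Nat.card K = q ^ 2 →
      D.ncard ≤ q ^ (n - 1) + 1) ∧
    (P.IsOddHermitianVariety n → ∀ q : ℕ, Nat.card K = q ^ 2 →
      D.ncard ≤ q ^ (3 * (n - 1)) + 1) := by
  have hK : 0 < Nat.card K := Nat.card_pos
  rcases eq_or_ne n 0 with rfl | hn0
  · -- In rank zero the only generator is the zero space.
    have h1 : D.ncard ≤ 1 := by
      rw [← Set.ncard_singleton (⊥ : Submodule K V)]
      exact Set.ncard_le_ncard (fun S hS => Submodule.finrank_eq_zero.1 (hDP S hS).2)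
    refine ⟨fun e _ => ?_, fun _ => by omega, fun _ => by omega, fun _ => by omega,
      fun _ => by omega, fun _ _ _ => by omega, fun _ _ _ => by omega⟩
    have h2 : (D.ncard : ℝ) ≤ 1 := by exact_mod_cast h1
    have h3 : (0 : ℝ) ≤ (Nat.card K : ℝ) ^ ((((0 : ℕ) : ℝ) - 1) * e) := by positivity
    linarith
  have hF := hrank.toPolarGeometry
  have hDF : ∀ S ∈ D, P.toPolarGeometry.IsGenerator n S := fun S hS =>
    (P.isGenerator_toPolarGeometry n S).2 (hDP S hS)
  have hpair : ∀ S ∈ D, ∀ T ∈ D, S ≠ T → finrank K (S ⊓ T : Submodule K V) = 1 :=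
    hD.elim (fun h => h.finrank_inf) fun h _ hS _ hT hne => h.finrank_inf hn0 hS hT hne
  have hbound : ∀ δ s : ℕ, finrank K V = 2 * n + δ → Nat.card K ^ δ * P.toPolarGeometry.τ = s →
      0 < s → D.ncard ≤ s ^ (n - 1) + 1 := by
    intro δ s hδ hτ hs
    have h := hF.ncard_le hn hn0 (s := (s : ℝ)) (by exact_mod_cast hs)
      (fun W hW hWn => by rw [hF.ncard_generators hδ hW hWn, hτ]; push_cast; rfl) D hDF hpair
    exact_mod_cast h
  have hqpos : ∀ q : ℕ, Nat.card K = q ^ 2 → 0 < q := fun q hq =>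
    Nat.pos_of_ne_zero fun h => by rw [hq, h] at hK; exact absurd hK (by norm_num)
  refine ⟨fun e he => ?_, fun h => ?_, fun h => ?_, fun h => ?_, fun h => ?_, fun h q hq => ?_,
    fun h q hq => ?_⟩
  · have hK' : (0 : ℝ) < Nat.card K := by exact_mod_cast hK
    have hb := hF.ncard_le hn hn0 (s := (Nat.card K : ℝ) ^ e) (Real.rpow_pos_of_pos hK' e)
      (fun W hW hWn => by
        simp_rw [P.isGenerator_toPolarGeometry]
        exact he W ((P.isTI_toPolarGeometry W).1 hW) hWn) D hDF hpair
    rwa [← Real.rpow_natCast, ← Real.rpow_mul hK'.le, Nat.cast_sub (Nat.one_le_iff_ne_zero.2 hn0),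
      Nat.cast_one, mul_comm] at hb
  · simpa using hbound 0 1 h.2.1 (by rw [h.1.τ_eq]; simp) one_pos
  · exact hbound 1 _ h.2.1 (by rw [h.1.τ_eq, pow_one, mul_one]) hK
  · have := hbound 2 (Nat.card K ^ 2) h.2.1 (by rw [h.1.τ_eq, mul_one]) (by positivity)
    rwa [← pow_mul, Nat.mul_sub] at this
  · exact hbound 0 _ h.2.1 (by rw [h.1.τ_eq, pow_zero, one_mul]) hK
  · exact hbound 0 q h.2.1 (by rw [h.1.τ_eq hq, pow_zero, one_mul]) (hqpos q hq)
  · have := hbound 1 (q ^ 3) h.2.1 (by rw [h.1.τ_eq hq, hq]; ring) (pow_pos (hqpos q hq) 3)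
    rwa [← pow_mul] at this
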